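/- Let $H$ be a torsion-free amenable group and $k$ a field of characteristic $0$ such that the group algebra $kH$ is not a domain. (A group is amenable if it admits a finitely additive probability measure, defined on all subsets, invariant under left and right translations. The uniform dimension $\operatorname{udim} kG$ is that of $kG$ as a right module over itself: it is $\infty$ if $kG$ contains an infinite direct sum of non-zero right ideals, and otherwise it is the maximal number of summands in a direct sum of non-zero right ideals of $kG$. For a group $D$, $D\wr C_\infty=\big(\bigoplus_{\mathbb Z}D\big)\rtimes C_\infty$ is the restricted wreath product with the infinite cyclic group.) Then: (1) There is a finitely generated torsion-free amenable group $G$ with $\operatorname{udim} kG=\infty$. Such a $G$ may be taken to be $H_0\wr C_\infty$ for some finitely generated subgroup $H_0\le H$ with $kH_0$ not a domain. (2) The group $H\wr C_\infty$ is torsion-free and amenable with $\operatorname{udim} k(H\wr C_\infty)=\infty$, and it is finitely generated if $H$ is finitely generated. In particular, $G$ in (1), and $H\wr C_\infty$ in (2), are counterexamples over the field $k$ of characteristic $0$ to the implication "if a group $G$ is amenable and there is a bound on the orders of its finite subgroups, then $\operatorname{udim} kG<\infty$". -/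

import Mathlib

universe u v

/-- A group is torsion-free if its only element of finite order is the identity. (Mathlib's
`IsMulTorsionFree` demands uniqueness of roots, which is stronger for nonabelian groups.) -/
def IsTorsionFreeGroup (G : Type*) [Group G] : Prop :=
  ∀ g : G, IsOfFinOrder g → g = 1

/-- A finitely additive, two-sided invariant probability measure on all subsets of `G`. -/
structure IsInvariantMean (G : Type*) [Group G] (μ : Set G → ℝ) : Prop where
  mem_Icc : ∀ A : Set G, μ A ∈ Set.Icc (0 : ℝ) 1
  univ : μ Set.univ = 1
  union : ∀ A B : Set G, Disjoint A B → μ (A ∪ B) = μ A + μ B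
  mul_left : ∀ (g : G) (A : Set G), μ ((fun x => g * x) '' A) = μ A
  mul_right : ∀ (g : G) (A : Set G), μ ((fun x => x * g) '' A) = μ A

/-- A (discrete) group is amenable if it carries a finitely additive invariant probability
measure. -/
def IsAmenableGroup (G : Type*) [Group G] : Prop :=
  ∃ μ : Set G → ℝ, IsInvariantMean G μ

/-- There is a bound on the orders of the finite subgroups of `G`. -/
def HasBoundedFiniteSubgroups (G : Type*) [Group G] : Prop :=
  ∃ N : ℕ, ∀ F : Subgroup G, Finite F → Nat.card F ≤ N

/-- The restricted regular wreath product `D ≀ Q`, that is `(⨁_Q D) ⋊ Q`, as the subgroup of the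
unrestricted regular wreath product `(Q → D) ⋊ Q` of the elements whose base component has
finite support. -/
def restrictedWreath (D Q : Type*) [Group D] [Group Q] : Subgroup (D ≀ᵣ Q) where
  carrier := {w | (Function.mulSupport w.left).Finite}
  one_mem' := by simp
  mul_mem' := by
    intro a b ha hb
    have hb' : (Function.mulSupport fun x => b.left (a.right⁻¹ * x)).Finite :=
      Set.Finite.preimage (mul_right_injective a.right⁻¹).injOn hb
    exact (Set.Finite.union ha hb').subset (Function.mulSupport_mul _ _)
  inv_mem' := by
    intro a ha
    have h : (Function.mulSupport fun x => a.left (a.right * x)).Finite :=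
      Set.Finite.preimage (mul_right_injective a.right).injOn ha
    refine h.subset ?_
    intro x hx
    simpa using hx

/-- `H ≀ C_∞`, with `C_∞` the infinite cyclic group. -/
abbrev Lamplighter (H : Type*) [Group H] : Type _ :=
  restrictedWreath H (Multiplicative ℤ)

section UniformDimension

variable (R M : Type*) [Ring R] [AddCommGroup M] [Module R M]

/-- `M` contains no infinite direct sum of non-zero submodules. -/
def HasFiniteUdim : Prop :=
  ¬ ∃ N : ℕ → Submodule R M, (∀ i, N i ≠ ⊥) ∧ iSupIndep N

open Classical in
/-- The uniform dimension of `M`: infinite if `M` contains an infinite direct sum of non-zero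
submodules, and otherwise the largest number of summands in a direct sum of non-zero submodules
of `M` (a set of natural numbers that is then bounded). -/
noncomputable def udim : ℕ∞ :=
  if HasFiniteUdim R M then
    ((sSup {n : ℕ | ∃ N : Fin n → Submodule R M, (∀ i, N i ≠ ⊥) ∧ iSupIndep N} : ℕ) : ℕ∞)
  else ⊤

theorem udim_eq_top_iff : udim R M = ⊤ ↔ ¬ HasFiniteUdim R M := by
  unfold udim
  split_ifs with h <;> simp [h]

end UniformDimension

/-- The right uniform dimension of a ring `R`: that of `R` as a right module over itself. -/
noncomputable def rightUdim (R : Type*) [Ring R] : ℕ∞ :=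
  udim Rᵐᵒᵖ R

/-! The algebraic heart is that a group algebra over a field of characteristic zero is right
nonsingular (`eq_zero_of_essentialAnnihilator`). Over ℂ this follows from the involution `conjInv`,
since x*x = 0 forces x = 0. A general field is handled by passing to the countable subfield
generated by the coefficients, which embeds in ℂ. If every two non-zero principal right ideals met,
a relation ab = 0 with b ≠ 0 would make the annihilator of a essential, so a = 0. Hence a non-domain
kD contains non-zero u, v with uR ∩ vR = 0 (`exists_rightIndependent`).

In `D ≀ Q` with Q infinite, put copies u_n, v_n of this pair at distinct places. Different copies
commute, and the elements v_0 ⋯ v_{n-1} u_n generate right ideals whose sum is direct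
(`rightUdim_eq_top_of_rightIndependent`).

Amenability of the wreath product is proved through Reiter's condition. It is equivalent to having
an invariant mean (`IsInvariantMean.isReiter`, `IsReiter.isAmenableGroup`) and passes easily to
subgroups, extensions and local unions. Finite generation in the first claim comes from replacing H
by the subgroup generated by the supports of two zero divisors. -/

/-! ### Right nonsingularity in characteristic zero. -/

open Cardinal in
/-- A countable field of characteristic zero embeds into the complex numbers. -/
theorem nonempty_ringHom_complex_of_countable (F : Type*) [Field F] [CharZero F] [Countable F] :
    Nonempty (F →+* ℂ) := by
  obtain ⟨s, hs⟩ := exists_isTranscendenceBasis ℤ F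
  obtain ⟨t, ht⟩ := exists_isTranscendenceBasis ℤ ℂ
  have hC : ℵ₀ < #ℂ := by rw [Cardinal.mk_complex]; exact Cardinal.aleph0_lt_continuum
  have ht' : #ℂ = #t := by
    simpa using IsAlgClosed.cardinal_eq_cardinal_transcendence_basis_of_aleph0_lt
      _ ht (le_of_eq Cardinal.mk_int) hC
  have : Infinite t := Cardinal.infinite_iff.2 (ht' ▸ hC.le)
  obtain ⟨e₁, he₁⟩ := exists_injective_nat s
  -- A transcendence basis of F is countable and one of ℂ is infinite, so the first embeds in the
  -- second. This embeds the polynomial subring A in ℂ, and F is algebraic over A.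
  let e : s ↪ t := (⟨e₁, he₁⟩ : s ↪ ℕ).trans (Infinite.natEmbedding t)
  let A := Algebra.adjoin ℤ (Set.range ((↑) : s → F))
  let φ : A →+* ℂ := ((MvPolynomial.aeval (R := ℤ) (fun i : t => (i : ℂ))).comp
    ((MvPolynomial.rename e).comp hs.1.aevalEquiv.symm.toAlgHom)).toRingHom
  have hφ : Function.Injective φ := by
    have h1 : Function.Injective (MvPolynomial.aeval (R := ℤ) (fun i : t => (i : ℂ))) := ht.1
    exact h1.comp ((MvPolynomial.rename_injective e e.injective).comp
      hs.1.aevalEquiv.symm.injective)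
  let : Algebra A ℂ := φ.toAlgebra
  have : FaithfulSMul A ℂ := (faithfulSMul_iff_algebraMap_injective A ℂ).2 hφ
  have : Algebra.IsAlgebraic A F := hs.isAlgebraic
  exact ⟨(IsAlgClosed.lift (R := A) (S := F) (M := ℂ)).toRingHom⟩

namespace MonoidAlgebra

variable {G : Type*} [Group G]

/-- The right annihilator of `a` is an essential right ideal. -/
def EssentialAnnihilator {R : Type*} [Semiring R] (a : R) : Prop :=
  ∀ x : R, x ≠ 0 → ∃ r, x * r ≠ 0 ∧ a * (x * r) = 0

section Functional

variable {K L : Type*} [Field K] [Field L] [Algebra K L]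

/-- A K-linear functional on L, applied to coefficients, is a map of left KG-modules from LG to KG.
With its right-handed twin it carries annihilation statements between the two algebras. -/
theorem map_map_algebraMap_mul (f : L →ₗ[K] K) (x : MonoidAlgebra K G) (y : MonoidAlgebra L G) :
    map (f : L →+ K) (mapRingHom G (algebraMap K L) x * y) = x * map (f : L →+ K) y := by
  induction x using MonoidAlgebra.induction_linear with
  | zero => simp
  | add p q hp hq => simp [add_mul, MonoidAlgebra.map_add, hp, hq]
  | single g c =>
    induction y using MonoidAlgebra.induction_linear with
    | zero => simp
    | add p q hp hq => rw [mul_add, MonoidAlgebra.map_add, hp, hq, MonoidAlgebra.map_add, mul_add]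
    | single h d =>
      simp [← Algebra.smul_def]

theorem map_mul_map_algebraMap (f : L →ₗ[K] K) (y : MonoidAlgebra L G) (x : MonoidAlgebra K G) :
    map (f : L →+ K) (y * mapRingHom G (algebraMap K L) x) = map (f : L →+ K) y * x := by
  induction x using MonoidAlgebra.induction_linear with
  | zero => simp
  | add p q hp hq => simp [mul_add, MonoidAlgebra.map_add, hp, hq]
  | single g c =>
    induction y using MonoidAlgebra.induction_linear with
    | zero => simp
    | add p q hp hq => rw [add_mul, MonoidAlgebra.map_add, hp, hq, MonoidAlgebra.map_add, add_mul]
    | single h d =>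
      simp [mul_comm _ (algebraMap K L c), ← Algebra.smul_def, mul_comm c]

theorem exists_map_ne_zero {x : MonoidAlgebra L G} (hx : x ≠ 0) :
    ∃ f : L →ₗ[K] K, map (f : L →+ K) x ≠ 0 := by
  obtain ⟨g, hg⟩ : ∃ g, x.coeff g ≠ 0 := by
    by_contra! h
    exact hx (by ext g; simp [h g])
  obtain ⟨f, hf⟩ : ∃ f : Module.Dual K L, f (x.coeff g) ≠ 0 := by
    by_contra! h
    exact hg ((Module.forall_dual_apply_eq_zero_iff K _).1 h)
  refine ⟨f, fun h => hf ?_⟩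
  have := congrArg (fun z => z.coeff g) h
  simpa using this

/-- The multiplier found over L is pushed down to K by a functional that does not kill the non-zero
product. -/
theorem EssentialAnnihilator.descend {a : MonoidAlgebra K G}
    (h : EssentialAnnihilator (mapRingHom G (algebraMap K L) a)) : EssentialAnnihilator a := by
  intro x hx
  obtain ⟨r, hr, har⟩ := h (mapRingHom G (algebraMap K L) x) fun h0 =>
    hx (map_injective _ (algebraMap K L).injective (h0.trans (MonoidAlgebra.map_zero _).symm))
  obtain ⟨f, hf⟩ := exists_map_ne_zero (K := K) hr
  refine ⟨map (f : L →+ K) r, ?_, ?_⟩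
  · rwa [← map_map_algebraMap_mul]
  · rw [← map_map_algebraMap_mul, ← map_map_algebraMap_mul, har, MonoidAlgebra.map_zero]

theorem EssentialAnnihilator.ascend {a : MonoidAlgebra K G} (h : EssentialAnnihilator a) :
    EssentialAnnihilator (mapRingHom G (algebraMap K L) a) := by
  classical
  intro x hx
  let B := Module.Basis.ofVectorSpace K L
  let c := fun i => (B.coord i : L →ₗ[K] K)
  have hc : ∀ z : MonoidAlgebra L G, (∀ i, map (c i : L →+ K) z = 0) → z = 0 := by
    intro z hz
    ext g
    refine B.ext_elem fun i => ?_
    have := congrArg (fun z => z.coeff g) (hz i)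
    simpa [c] using this
  -- In a K-basis of L, x has finitely many non-zero coordinates in KG. A single multiplier over K
  -- must serve them all while keeping the product with x non-zero. Coordinates are treated one at a
  -- time, and multiplying further on the right preserves what is already annihilated.
  have key : ∀ F : Finset (Module.Basis.ofVectorSpaceIndex K L), ∃ r : MonoidAlgebra K G,
      x * mapRingHom G (algebraMap K L) r ≠ 0 ∧
      ∀ i ∈ F, a * (map (c i : L →+ K) x * r) = 0 := by
    intro F
    induction F using Finset.induction_on with
    | empty => exact ⟨1, by simpa using hx, by simp⟩
    | insert i F hi ih =>
      obtain ⟨r, hr, hF⟩ := ih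
      by_cases h0 : map (c i : L →+ K) x * r = 0
      · refine ⟨r, hr, fun j hj => ?_⟩
        rcases Finset.mem_insert.1 hj with rfl | hj
        · rw [h0, mul_zero]
        · exact hF j hj
      · obtain ⟨s, hs, has⟩ := h _ h0
        refine ⟨r * s, fun h1 => hs ?_, fun j hj => ?_⟩
        · rw [mul_assoc, ← map_mul_map_algebraMap, h1, MonoidAlgebra.map_zero]
        · rcases Finset.mem_insert.1 hj with rfl | hj
          · rw [← mul_assoc (map _ x), has]
          · rw [← mul_assoc (map _ x), ← mul_assoc a, hF j hj, zero_mul]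
  obtain ⟨r, hr, hF⟩ := key (x.coeff.support.biUnion fun g => (B.repr (x.coeff g)).support)
  refine ⟨mapRingHom G (algebraMap K L) r, hr, hc _ fun i => ?_⟩
  rw [map_map_algebraMap_mul, map_mul_map_algebraMap]
  by_cases hi : i ∈ x.coeff.support.biUnion fun g => (B.repr (x.coeff g)).support
  · exact hF i hi
  · have : map (c i : L →+ K) x = 0 := by
      ext g
      simp only [Finset.mem_biUnion, not_exists, not_and, Finsupp.mem_support_iff, not_not] at hi
      by_cases hg : x.coeff g = 0
      · simp [hg]
      · simpa [c] using hi g hg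
    rw [this, zero_mul, mul_zero]

end Functional

/-- The adjoint of an element of a complex group algebra. -/
noncomputable def conjInv (x : MonoidAlgebra ℂ G) : MonoidAlgebra ℂ G :=
  mapDomain (fun g => g⁻¹) (map (starRingEnd ℂ : ℂ →+ ℂ) x)

theorem conjInv_mul (x y : MonoidAlgebra ℂ G) : conjInv (x * y) = conjInv y * conjInv x := by
  induction x using MonoidAlgebra.induction_linear with
  | zero => simp [conjInv]
  | add p q hp hq =>
    simp only [conjInv, add_mul, MonoidAlgebra.map_add, mapDomain_add, mul_add] at *
    rw [hp, hq]
  | single g c =>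
    induction y using MonoidAlgebra.induction_linear with
    | zero => simp [conjInv]
    | add p q hp hq =>
      simp only [conjInv, add_mul, MonoidAlgebra.map_add, mapDomain_add, mul_add] at *
      rw [hp, hq]
    | single h d =>
      simp [conjInv, mul_comm]

theorem conjInv_conjInv (x : MonoidAlgebra ℂ G) : conjInv (conjInv x) = x := by
  induction x using MonoidAlgebra.induction_linear with
  | zero => simp [conjInv]
  | add p q hp hq =>
    simp only [conjInv, MonoidAlgebra.map_add, mapDomain_add] at *
    rw [hp, hq]
  | single g c => simp [conjInv]

theorem coeff_conjInv (x : MonoidAlgebra ℂ G) (g : G) :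
    (conjInv x).coeff g = starRingEnd ℂ (x.coeff g⁻¹) := by
  induction x using MonoidAlgebra.induction_linear with
  | zero => simp [conjInv]
  | add p q hp hq =>
    simp only [conjInv, MonoidAlgebra.map_add, mapDomain_add, coeff_add, Finsupp.add_apply,
      _root_.map_add] at *
    rw [hp, hq]
  | single h c =>
    classical
    simp only [conjInv, map_single, mapDomain_single, coeff_single, Finsupp.single_apply,
      inv_eq_iff_eq_inv]
    split_ifs <;> simp

/-- The coefficient of x*x at the identity is the sum of the |x_g|². -/
theorem eq_zero_of_conjInv_mul_self {x : MonoidAlgebra ℂ G} (h : conjInv x * x = 0) : x = 0 := by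
  have h1 : (conjInv x * x).coeff 1 = 0 := by rw [h]; simp
  rw [coeff_mul_apply_right] at h1
  simp only [coeff_conjInv, one_mul, inv_inv] at h1
  have h2 : (x.coeff.sum fun _ z => Complex.normSq z) = 0 := by
    have h3 : ((x.coeff.sum fun _ z => Complex.normSq z : ℝ) : ℂ) = 0 := by
      rw [← h1]
      simp only [Finsupp.sum, Complex.ofReal_sum, Complex.normSq_eq_conj_mul_self]
    exact_mod_cast h3
  rw [Finsupp.sum, Finset.sum_eq_zero_iff_of_nonneg fun _ _ => Complex.normSq_nonneg _] at h2
  ext g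
  by_contra hg
  exact hg (Complex.normSq_eq_zero.1 (h2 g (Finsupp.mem_support_iff.2 hg)))

/-- Essentiality is tested on a*: if aa*r = 0, then (a*r)*(a*r) = r*aa*r = 0, so a*r = 0. -/
theorem eq_zero_of_essentialAnnihilator_complex {a : MonoidAlgebra ℂ G}
    (h : EssentialAnnihilator a) : a = 0 := by
  by_contra ha
  have ha' : conjInv a ≠ 0 := fun h0 => ha (by rw [← conjInv_conjInv a, h0]; simp [conjInv])
  obtain ⟨r, hr, har⟩ := h _ ha'
  refine hr (eq_zero_of_conjInv_mul_self ?_)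
  rw [conjInv_mul, conjInv_conjInv, mul_assoc, har, mul_zero]

/-- Group algebras over fields of characteristic zero are right nonsingular. -/
theorem eq_zero_of_essentialAnnihilator {k : Type*} [Field k] [CharZero k] {a : MonoidAlgebra k G}
    (h : EssentialAnnihilator a) : a = 0 := by
  let F : Subfield k := Subfield.closure (a.coeff '' a.coeff.support)
  have : Countable F := by
    rw [← Cardinal.mk_le_aleph0_iff]
    refine (Subfield.cardinalMk_closure_le_max _).trans (max_le ?_ le_rfl)
    exact Cardinal.mk_le_aleph0_iff.2
      (Set.Finite.countable (a.coeff.support.finite_toSet.image _)).to_subtype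
  obtain ⟨a', ha'⟩ : ∃ a' : MonoidAlgebra F G, mapRingHom G (algebraMap F k) a' = a := by
    have : a ∈ Set.range (map (M := G) (algebraMap F k : F →+ k)) := by
      rw [range_map]
      intro g
      by_cases hg : a.coeff g = 0
      · exact ⟨0, by simp [hg]⟩
      · exact ⟨⟨a.coeff g, Subfield.subset_closure
          ⟨g, by simpa using hg, rfl⟩⟩, rfl⟩
    exact this
  obtain ⟨σ⟩ := nonempty_ringHom_complex_of_countable F
  let : Algebra F ℂ := σ.toAlgebra
  have h1 := eq_zero_of_essentialAnnihilator_complex ((ha'.symm ▸ h).descend.ascend (L := ℂ))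
  have h2 : a' = 0 := map_injective _ (algebraMap F ℂ).injective (h1.trans (MonoidAlgebra.map_zero _).symm)
  rw [← ha', h2, _root_.map_zero]

/-- The principal right ideals generated by `u` and `v` intersect trivially. -/
def RightIndependent {R : Type*} [Semiring R] (u v : R) : Prop :=
  ∀ r s, u * r = v * s → u * r = 0

/-- If no such pair exists and ab = 0 with b ≠ 0, every non-zero xR meets bR, which a annihilates.
So a has an essential annihilator and vanishes. -/
theorem exists_rightIndependent {k : Type*} [Field k] [CharZero k]
    (h : ¬ IsDomain (MonoidAlgebra k G)) :
    ∃ u v : MonoidAlgebra k G, u ≠ 0 ∧ v ≠ 0 ∧ RightIndependent u v := by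
  by_contra! hU
  simp only [RightIndependent, not_forall] at hU
  refine h (@NoZeroDivisors.to_isDomain _ _ _ ⟨fun {a b} hab => ?_⟩)
  by_contra! hne
  refine hne.1 (eq_zero_of_essentialAnnihilator fun x hx => ?_)
  obtain ⟨r, s, hrs, h0⟩ := hU x b hx hne.2
  exact ⟨r, h0, by rw [hrs, ← mul_assoc, hab, zero_mul]⟩

end MonoidAlgebra

/-! ### Infinite direct sums from commuting independent pairs. -/

open MulOpposite in
/-- A sequence of right-independent pairs whose members at different places commute produces an
infinite direct sum of principal right ideals. -/
theorem rightUdim_eq_top_of_rightIndependent {R : Type*} [Ring R] (u v P : ℕ → R)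
    (hP0 : P 0 = 1) (hP : ∀ n, P (n + 1) = P n * v n)
    (hvu : ∀ i j, i < j → Commute (v i) (u j)) (hvv : ∀ i j, i < j → Commute (v i) (v j))
    (hind : ∀ n, MonoidAlgebra.RightIndependent (u n) (v n)) (hne : ∀ n, P n * u n ≠ 0) :
    rightUdim R = ⊤ := by
  have hPu : ∀ n j, n ≤ j → Commute (P n) (u j) := by
    intro n
    induction n with
    | zero => intro j _; rw [hP0]; exact Commute.one_left _
    | succ n ih => intro j hj; rw [hP]; exact (ih j (by omega)).mul_left (hvu n j (by omega))
  have hPv : ∀ n j, n ≤ j → Commute (P n) (v j) := by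
    intro n
    induction n with
    | zero => intro j _; rw [hP0]; exact Commute.one_left _
    | succ n ih => intro j hj; rw [hP]; exact (ih j (by omega)).mul_left (hvv n j (by omega))
  have hdvd : ∀ n d, ∃ z, P (n + 1 + d) = P n * v n * z := by
    intro n d
    induction d with
    | zero => exact ⟨1, by simp [hP]⟩
    | succ d ih =>
      obtain ⟨z, hz⟩ := ih
      exact ⟨z * v (n + 1 + d), by rw [← add_assoc, hP, hz, mul_assoc]⟩
  rw [rightUdim, udim_eq_top_iff, HasFiniteUdim, not_not]
  refine ⟨fun n => Submodule.span Rᵐᵒᵖ {P n * u n}, fun n => ?_, ?_⟩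
  · rw [Ne, Submodule.span_singleton_eq_bot]
    exact hne n
  rw [iSupIndep_iff_finsetSum_eq_zero_imp_eq_zero]
  intro s x hx hsum
  choose! r hr using fun i hi => Submodule.mem_span_singleton.1 (hx i hi)
  intro i
  induction i using Nat.strong_induction_on with
  | _ i ih =>
    intro hi
    -- Earlier terms vanish by induction, and every later term lies in the right ideal of `P i * v
    -- i`.
    obtain ⟨z, hz⟩ : ∃ z, ∑ j ∈ s.erase i, x j = P i * v i * z := by
      refine Finset.sum_induction _ (fun y => ∃ z, y = P i * v i * z) ?_ ⟨0, by simp⟩ ?_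
      · rintro _ _ ⟨a, rfl⟩ ⟨b, rfl⟩
        exact ⟨a + b, by rw [mul_add]⟩
      · intro j hj
        obtain ⟨hji, hjs⟩ := Finset.mem_erase.1 hj
        rcases lt_or_gt_of_ne hji with h | h
        · exact ⟨0, by rw [ih j h hjs, mul_zero]⟩
        · obtain ⟨d, rfl⟩ := Nat.exists_eq_add_of_lt h
          obtain ⟨w, hw⟩ := hdvd i d
          refine ⟨w * u (i + d + 1) * (r (i + d + 1)).unop, ?_⟩
          rw [← hr _ hjs, show i + d + 1 = i + 1 + d by omega, hw, smul_eq_mul_unop]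
          simp only [mul_assoc]
    -- Commuting `P i` past `u i` and `v i` puts these on the left, where their independence
    -- applies; `P i` never has to be cancelled.
    rw [← Finset.add_sum_erase _ _ hi, hz, ← hr i hi, smul_eq_mul_unop,
      (hPu i i le_rfl).eq, (hPv i i le_rfl).eq] at hsum
    rw [← hr i hi, smul_eq_mul_unop, (hPu i i le_rfl).eq, mul_assoc]
    refine hind i _ (-(P i * z)) ?_
    rw [mul_neg, ← mul_assoc, ← mul_assoc]
    exact eq_neg_of_add_eq_zero_left hsum

/-! ### Transfer along embeddings of groups. -/

namespace MonoidAlgebra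

variable {k D G : Type*} [Field k] [Group D] [Group G]

/-- Here `f` parametrizes a right coset of the image of `j`; restriction to such a coset commutes
with left multiplication by kD. -/
theorem comapDomain_mapDomain_mul (j : D →* G) (f : D → G) (hf : Function.Injective f)
    (hfj : ∀ d h, f (d * h) = j d * f h) (u : MonoidAlgebra k D) (r : MonoidAlgebra k G) :
    comapDomain f hf (mapDomain j u * r) = u * comapDomain f hf r := by
  induction u using MonoidAlgebra.induction_linear with
  | zero => simp
  | add p q hp hq => simp only [mapDomain_add, add_mul, comapDomain_add, hp, hq]
  | single d c =>
    ext h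
    simp [coeff_single_mul_apply, hfj]

/-- As a left kD-module, kG splits over the right cosets of D, so independence is checked on each
coset separately. -/
theorem RightIndependent.mapDomain {u v : MonoidAlgebra k D} (huv : RightIndependent u v)
    (j : D →* G) (hj : Function.Injective j) :
    RightIndependent (mapDomain j u) (mapDomain j v) := by
  intro r s hrs
  ext g
  have hf : Function.Injective fun h => j h * g := fun _ _ h => hj (mul_right_cancel h)
  have hfj : ∀ d h, j (d * h) * g = j d * (j h * g) := fun d h => by rw [map_mul, mul_assoc]
  have h1 := huv (comapDomain _ hf r) (comapDomain _ hf s) <| by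
    rw [← comapDomain_mapDomain_mul j _ hf hfj, ← comapDomain_mapDomain_mul j _ hf hfj, hrs]
  rw [← comapDomain_mapDomain_mul j _ hf hfj] at h1
  have := congrArg (fun z => z.coeff 1) h1
  simp only [coeff_comapDomain, Finsupp.comapDomain_apply, map_one, one_mul] at this
  exact this

/-- Since `S` meets the image of `j` trivially, the products of elements of the two supports are all
distinct and no coefficient can cancel. -/
theorem mul_mapDomain_ne_zero (j : D →* G) (S : Subgroup G)
    (hS : ∀ d, j d ∈ S → d = 1) {y : MonoidAlgebra k G} (hy : y ≠ 0)
    (hyS : ∀ g, y.coeff g ≠ 0 → g ∈ S) {u : MonoidAlgebra k D} (hu : u ≠ 0) :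
    y * mapDomain j u ≠ 0 := by
  obtain ⟨g, hg⟩ : ∃ g, y.coeff g ≠ 0 := by
    by_contra! h
    exact hy (by ext g; simp [h g])
  obtain ⟨d, hd⟩ : ∃ d, u.coeff d ≠ 0 := by
    by_contra! h
    exact hu (by ext g; simp [h g])
  intro h0
  have h1 : (y * mapDomain j u).coeff (g * j d) = 0 := by rw [h0]; simp
  rw [coeff_mul_apply_right] at h1
  change (Finsupp.mapDomain j u.coeff).sum _ = 0 at h1
  rw [Finsupp.sum_mapDomain_index (by simp) (by intros; ring), Finsupp.sum,
    Finset.sum_eq_single d] at h1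
  · simp [hg, hd] at h1
  · intro b _ hb
    by_contra hne
    have h2 := hyS _ (left_ne_zero_of_mul hne)
    have h3 : j (d * b⁻¹) ∈ S := by
      have := S.mul_mem (S.inv_mem (hyS g hg)) h2
      simpa [mul_assoc] using this
    exact hb (mul_inv_eq_one.1 (hS _ h3)).symm
  · intro h
    exact absurd (Finsupp.mem_support_iff.2 hd) h

theorem commute_mapDomain {D' : Type*} [Group D'] (i : D →* G) (j : D' →* G)
    (hij : ∀ a b, Commute (i a) (j b)) (x : MonoidAlgebra k D) (y : MonoidAlgebra k D') :
    Commute (mapDomain i x) (mapDomain j y) := by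
  induction x using MonoidAlgebra.induction_linear with
  | zero => simp
  | add p q hp hq => rw [mapDomain_add]; exact hp.add_left hq
  | single g c =>
    induction y using MonoidAlgebra.induction_linear with
    | zero => simp
    | add p q hp hq => rw [mapDomain_add]; exact hp.add_right hq
    | single h d =>
      simp only [mapDomain_single]
      exact single_commute_single (hij g h) (Commute.all c d)

theorem coeff_mul_mem_of_ne_zero (S : Subgroup G) {x y : MonoidAlgebra k G}
    (hx : ∀ g, x.coeff g ≠ 0 → g ∈ S) (hy : ∀ g, y.coeff g ≠ 0 → g ∈ S) (g : G)
    (hg : (x * y).coeff g ≠ 0) : g ∈ S := by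
  classical
  have := support_coeff_mul_subset x y (Finsupp.mem_support_iff.2 hg)
  obtain ⟨a, ha, b, hb, rfl⟩ := Finset.mem_mul.1 this
  exact S.mul_mem (hx a (Finsupp.mem_support_iff.1 ha)) (hy b (Finsupp.mem_support_iff.1 hb))

theorem coeff_mapDomain_mem_of_ne_zero {A B : Type*} {i : A → B} {S : Set B} (hi : ∀ d, i d ∈ S)
    (x : MonoidAlgebra k A) (g : B) (hg : (mapDomain i x).coeff g ≠ 0) : g ∈ S := by
  classical
  have := Finsupp.mapDomain_support (Finsupp.mem_support_iff.2 hg)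
  obtain ⟨d, -, rfl⟩ := Finset.mem_image.1 this
  exact hi d

end MonoidAlgebra

/-! ### Uniform dimension of wreath products. -/

section Wreath

variable {D Q : Type*} [Group D] [Group Q]

open Classical in
/-- The copy of `D` at the place `q` in the restricted wreath product. -/
noncomputable def wreathSingle (q : Q) : D →* restrictedWreath D Q where
  toFun d := ⟨⟨Pi.mulSingle q d, 1⟩, (Set.finite_singleton q).subset Pi.mulSupport_mulSingle_subset⟩
  map_one' := by ext <;> simp
  map_mul' a b := by ext <;> simp [Pi.mulSingle_mul]

open Classical in
@[simp]
theorem wreathSingle_left (q : Q) (d : D) :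
    (wreathSingle q d : D ≀ᵣ Q).left = Pi.mulSingle q d := rfl

@[simp]
theorem wreathSingle_right (q : Q) (d : D) : (wreathSingle q d : D ≀ᵣ Q).right = 1 := rfl

theorem wreathSingle_injective (q : Q) : Function.Injective (wreathSingle (D := D) q) := by
  intro a b h
  have := congrFun (congrArg (fun w : restrictedWreath D Q => (w : D ≀ᵣ Q).left) h) q
  simpa using this

theorem commute_wreathSingle {p q : Q} (hpq : p ≠ q) (a b : D) :
    Commute (wreathSingle p a) (wreathSingle q b) := by
  classical
  ext x
  · have := congrFun (Pi.mulSingle_commute (f := fun _ : Q => D) hpq a b).eq x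
    simpa [Pi.mulSingle] using this
  · simp

/-- The elements of the base group that are trivial on a set of places. -/
def baseTrivialOn (D : Type*) [Group D] (A : Set Q) : Subgroup (restrictedWreath D Q) where
  carrier := {w | (w : D ≀ᵣ Q).right = 1 ∧ ∀ q ∈ A, (w : D ≀ᵣ Q).left q = 1}
  one_mem' := by simp
  mul_mem' := by
    rintro a b ⟨ha, ha'⟩ ⟨hb, hb'⟩
    refine ⟨by simp [ha, hb], fun q hq => by simp [ha, ha' q hq, hb' q hq]⟩
  inv_mem' := by
    rintro a ⟨ha, ha'⟩
    refine ⟨by simp [ha], fun q hq => by simp [ha, ha' q hq]⟩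

/-- If `kD` is not a domain, the group algebra of `D ≀ Q` with `Q` infinite has infinite uniform
dimension. -/
theorem rightUdim_restrictedWreath [Infinite Q] {k : Type*} [Field k] [CharZero k]
    (hD : ¬ IsDomain (MonoidAlgebra k D)) :
    rightUdim (MonoidAlgebra k (restrictedWreath D Q)) = ⊤ := by
  classical
  obtain ⟨u, v, hu, hv, huv⟩ := MonoidAlgebra.exists_rightIndependent hD
  let e : ℕ ↪ Q := Infinite.natEmbedding Q
  let U : ℕ → MonoidAlgebra k (restrictedWreath D Q) := fun n =>
    MonoidAlgebra.mapDomain (wreathSingle (e n)) u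
  let V : ℕ → MonoidAlgebra k (restrictedWreath D Q) := fun n =>
    MonoidAlgebra.mapDomain (wreathSingle (e n)) v
  let P : ℕ → MonoidAlgebra k (restrictedWreath D Q) := fun n =>
    Nat.rec 1 (fun n p => p * V n) n
  -- `P n` involves only the places `e 0`, …, `e (n - 1)`, so it is supported in `S n`, which meets
  -- the copy of D at `e n` trivially.
  let S : ℕ → Subgroup (restrictedWreath D Q) := fun n => baseTrivialOn D (e '' Set.Ici n)
  have hS : ∀ n d, wreathSingle (e n) d ∈ S n → d = 1 := by
    intro n d h
    simpa using h.2 (e n) ⟨n, Set.self_mem_Ici, rfl⟩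
  have hP : ∀ n, P n ≠ 0 ∧ ∀ g, (P n).coeff g ≠ 0 → g ∈ S n := by
    intro n
    induction n with
    | zero =>
      refine ⟨one_ne_zero, fun g hg => ?_⟩
      have : g = 1 := by
        by_contra h
        exact hg (by simp [P, MonoidAlgebra.one_def, Ne.symm h])
      exact this ▸ (S 0).one_mem
    | succ n ih =>
      have hV : ∀ d, wreathSingle (e n) d ∈ S (n + 1) := by
        refine fun d => ⟨rfl, ?_⟩
        rintro _ ⟨m, hm, rfl⟩
        have : e m ≠ e n := e.injective.ne (by rw [Set.mem_Ici] at hm; omega)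
        simp [this]
      refine ⟨MonoidAlgebra.mul_mapDomain_ne_zero _ (S n) (hS n) ih.1 ih.2 hv,
        MonoidAlgebra.coeff_mul_mem_of_ne_zero _ (fun g hg => ?_)
          (fun g hg => MonoidAlgebra.coeff_mapDomain_mem_of_ne_zero
            (S := (S (n + 1) : Set (restrictedWreath D Q))) hV v g hg)⟩
      obtain ⟨h1, h2⟩ := ih.2 g hg
      exact ⟨h1, fun q hq => h2 q (Set.image_mono (Set.Ici_subset_Ici.2 n.le_succ) hq)⟩
  have hcomm : ∀ (i j : ℕ) (x y : MonoidAlgebra k D), i < j →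
      Commute (MonoidAlgebra.mapDomain (wreathSingle (e i)) x)
        (MonoidAlgebra.mapDomain (wreathSingle (e j)) y) := fun i j x y hij =>
    MonoidAlgebra.commute_mapDomain _ _ (commute_wreathSingle (e.injective.ne hij.ne)) x y
  exact rightUdim_eq_top_of_rightIndependent U V P rfl (fun _ => rfl)
    (fun i j hij => hcomm i j v u hij) (fun i j hij => hcomm i j v v hij)
    (fun n => huv.mapDomain _ (wreathSingle_injective _))
    (fun n => MonoidAlgebra.mul_mapDomain_ne_zero _ (S n) (hS n)
      (hP n).1 (hP n).2 hu)

end Wreath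

/-! ### Finitely supported measures and the ℓ¹ norm. -/

namespace MonoidAlgebra

variable {G K : Type*}

/-- The `ℓ¹` norm of a finitely supported function. -/
noncomputable def l1 (p : MonoidAlgebra ℝ G) : ℝ := p.coeff.sum fun _ c => |c|

/-- The total mass of a finitely supported function. -/
noncomputable def mass (p : MonoidAlgebra ℝ G) : ℝ := p.coeff.sum fun _ c => c

/-- A finitely supported probability measure. -/
structure IsProb (p : MonoidAlgebra ℝ G) : Prop where
  nonneg : ∀ g, 0 ≤ p.coeff g
  mass_eq : mass p = 1

theorem l1_nonneg (p : MonoidAlgebra ℝ G) : 0 ≤ l1 p := Finset.sum_nonneg fun _ _ => abs_nonneg _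

@[simp] theorem l1_zero : l1 (0 : MonoidAlgebra ℝ G) = 0 := by simp [l1]

@[simp] theorem l1_single (g : G) (c : ℝ) : l1 (single g c) = |c| := by
  simp [l1, Finsupp.sum_single_index]

theorem l1_eq_sum {p : MonoidAlgebra ℝ G} {s : Finset G} (hs : p.coeff.support ⊆ s) :
    l1 p = ∑ g ∈ s, |p.coeff g| := Finsupp.sum_of_support_subset _ hs _ (by simp)

theorem l1_add_le (p q : MonoidAlgebra ℝ G) : l1 (p + q) ≤ l1 p + l1 q := by
  classical
  rw [l1_eq_sum (p := p + q) Finsupp.support_add,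
    l1_eq_sum (p := p) (Finset.subset_union_left (s₂ := q.coeff.support)),
    l1_eq_sum (p := q) (Finset.subset_union_right (s₁ := p.coeff.support)),
    ← Finset.sum_add_distrib]
  exact Finset.sum_le_sum fun g _ => by simpa using abs_add_le _ _

theorem l1_smul (c : ℝ) (p : MonoidAlgebra ℝ G) : l1 (c • p) = |c| * l1 p := by
  rw [l1_eq_sum (p := c • p) (s := p.coeff.support) Finsupp.support_smul,
    l1_eq_sum (p := p) subset_rfl, Finset.mul_sum]
  exact Finset.sum_congr rfl fun g _ => by simp [abs_mul]

theorem l1_neg (p : MonoidAlgebra ℝ G) : l1 (-p) = l1 p := by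
  simpa using l1_smul (-1) p

theorem l1_sub_comm (p q : MonoidAlgebra ℝ G) : l1 (p - q) = l1 (q - p) := by
  rw [← l1_neg, neg_sub]

theorem l1_sum_le {ι : Type*} (s : Finset ι) (f : ι → MonoidAlgebra ℝ G) :
    l1 (∑ i ∈ s, f i) ≤ ∑ i ∈ s, l1 (f i) :=
  Finset.le_sum_of_subadditive l1 l1_zero.le l1_add_le s f

theorem eq_zero_of_l1 {p : MonoidAlgebra ℝ G} (h : l1 p = 0) : p = 0 := by
  rw [l1, Finsupp.sum, Finset.sum_eq_zero_iff_of_nonneg fun _ _ => abs_nonneg _] at h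
  ext g
  by_contra hg
  exact hg (abs_eq_zero.1 (h g (Finsupp.mem_support_iff.2 hg)))

theorem mapDomain_eq_sum (f : G → K) (p : MonoidAlgebra ℝ G) :
    mapDomain f p = ∑ g ∈ p.coeff.support, single (f g) (p.coeff g) := by
  ext x
  simp [mapDomain, Finsupp.mapDomain, Finsupp.sum]

theorem l1_mapDomain_le (f : G → K) (p : MonoidAlgebra ℝ G) : l1 (mapDomain f p) ≤ l1 p := by
  rw [mapDomain_eq_sum]
  exact (l1_sum_le _ _).trans (le_of_eq (by simp only [l1_single]; rfl))

theorem mapDomain_sub (f : G → K) (p q : MonoidAlgebra ℝ G) :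
    mapDomain f (p - q) = mapDomain f p - mapDomain f q := by
  rw [eq_sub_iff_add_eq, ← mapDomain_add, sub_add_cancel]

theorem l1_mul_le [Group G] (p q : MonoidAlgebra ℝ G) : l1 (p * q) ≤ l1 p * l1 q := by
  rw [mul_def, Finsupp.sum, l1_eq_sum (p := p) subset_rfl, Finset.sum_mul]
  refine (l1_sum_le _ _).trans (Finset.sum_le_sum fun g _ => ?_)
  rw [Finsupp.sum, l1_eq_sum (p := q) subset_rfl, Finset.mul_sum]
  exact (l1_sum_le _ _).trans (Finset.sum_le_sum fun h _ => by simp [abs_mul])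

@[simp] theorem mass_zero : mass (0 : MonoidAlgebra ℝ G) = 0 := by simp [mass]

@[simp] theorem mass_single (g : G) (c : ℝ) : mass (single g c) = c := by
  simp [mass, Finsupp.sum_single_index]

theorem mass_add (p q : MonoidAlgebra ℝ G) : mass (p + q) = mass p + mass q :=
  Finsupp.sum_add_index' (by simp) (by simp)

theorem mass_smul (c : ℝ) (p : MonoidAlgebra ℝ G) : mass (c • p) = c * mass p := by
  rw [mass, coeff_smul, Finsupp.sum_smul_index (by simp), mass, Finsupp.mul_sum]

theorem mass_mapDomain (f : G → K) (p : MonoidAlgebra ℝ G) : mass (mapDomain f p) = mass p :=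
  Finsupp.sum_mapDomain_index (by simp) (by simp)

theorem mass_mul [Group G] (p q : MonoidAlgebra ℝ G) : mass (p * q) = mass p * mass q := by
  induction p using MonoidAlgebra.induction_linear with
  | zero => simp
  | add p p' hp hp' => simp only [add_mul, mass_add, hp, hp']
  | single g c =>
    induction q using MonoidAlgebra.induction_linear with
    | zero => simp
    | add q q' hq hq' => simp only [mul_add, mass_add, hq, hq']
    | single h d => simp

theorem IsProb.l1_eq {p : MonoidAlgebra ℝ G} (hp : IsProb p) : l1 p = 1 := by
  rw [← hp.mass_eq, l1, mass]
  exact Finsupp.sum_congr fun g _ => abs_of_nonneg (hp.nonneg g)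

theorem IsProb.single (g : G) : IsProb (single g (1 : ℝ)) := by
  classical
  refine ⟨fun h => ?_, by simp⟩
  rw [coeff_single, Finsupp.single_apply]
  split_ifs <;> simp

theorem IsProb.mapDomain {p : MonoidAlgebra ℝ G} (hp : IsProb p) (f : G → K) :
    IsProb (mapDomain f p) := by
  classical
  refine ⟨fun h => ?_, by rw [mass_mapDomain, hp.mass_eq]⟩
  rw [mapDomain_eq_sum, coeff_sum, Finsupp.finsetSum_apply]
  refine Finset.sum_nonneg fun g _ => ?_
  rw [coeff_single, Finsupp.single_apply]
  split_ifs
  · exact hp.nonneg g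
  · exact le_rfl

theorem IsProb.mul [Group G] {p q : MonoidAlgebra ℝ G} (hp : IsProb p) (hq : IsProb q) :
    IsProb (p * q) := by
  refine ⟨fun g => ?_, by rw [mass_mul, hp.mass_eq, hq.mass_eq, mul_one]⟩
  rw [coeff_mul_apply_right]
  exact Finset.sum_nonneg fun h _ => mul_nonneg (hp.nonneg _) (hq.nonneg _)

theorem convex_isProb : Convex ℝ {p : MonoidAlgebra ℝ G | IsProb p} := by
  intro p hp q hq a b ha hb hab
  refine ⟨fun g => ?_, ?_⟩
  · simpa using add_nonneg (mul_nonneg ha (hp.nonneg g)) (mul_nonneg hb (hq.nonneg g))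
  · rw [mass_add, mass_smul, mass_smul, hp.mass_eq, hq.mass_eq, mul_one, mul_one, hab]

/-- The mass that a finitely supported function gives to a set. -/
noncomputable def massOn (A : Set G) (p : MonoidAlgebra ℝ G) : ℝ :=
  p.coeff.sum fun g c => A.indicator (fun _ => c) g

theorem massOn_add (A : Set G) (p q : MonoidAlgebra ℝ G) :
    massOn A (p + q) = massOn A p + massOn A q :=
  Finsupp.sum_add_index' (by simp) (fun g a b => by
    by_cases h : g ∈ A <;> simp [h])

@[simp] theorem massOn_zero (A : Set G) : massOn A (0 : MonoidAlgebra ℝ G) = 0 := by simp [massOn]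

@[simp] theorem massOn_single (A : Set G) (g : G) (c : ℝ) :
    massOn A (single g c) = A.indicator (fun _ => c) g := by
  simp [massOn, Finsupp.sum_single_index]

theorem massOn_sub (A : Set G) (p q : MonoidAlgebra ℝ G) :
    massOn A (p - q) = massOn A p - massOn A q := by
  rw [eq_sub_iff_add_eq, ← massOn_add, sub_add_cancel]

theorem abs_massOn_le (A : Set G) (p : MonoidAlgebra ℝ G) : |massOn A p| ≤ l1 p := by
  refine (Finset.abs_sum_le_sum_abs _ _).trans (Finset.sum_le_sum fun g _ => ?_)
  by_cases h : g ∈ A <;> simp [h]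

theorem IsProb.massOn_mem {p : MonoidAlgebra ℝ G} (hp : IsProb p) (A : Set G) :
    massOn A p ∈ Set.Icc (0 : ℝ) 1 :=
  ⟨Finset.sum_nonneg fun g _ => Set.indicator_nonneg (fun _ _ => hp.nonneg g) g,
    (le_abs_self _).trans ((abs_massOn_le A p).trans hp.l1_eq.le)⟩

theorem IsProb.massOn_univ {p : MonoidAlgebra ℝ G} (hp : IsProb p) : massOn Set.univ p = 1 := by
  rw [← hp.mass_eq]
  simp [massOn, mass]

theorem massOn_union {A B : Set G} (h : Disjoint A B) (p : MonoidAlgebra ℝ G) :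
    massOn (A ∪ B) p = massOn A p + massOn B p := by
  rw [massOn, massOn, massOn, ← Finsupp.sum_add]
  exact Finsupp.sum_congr fun g _ => by rw [Set.indicator_union_of_disjoint h]

theorem massOn_image_mul_left [Group G] (A : Set G) (g : G) (p : MonoidAlgebra ℝ G) :
    massOn ((fun x => g * x) '' A) p = massOn A (single g⁻¹ 1 * p) := by
  induction p using MonoidAlgebra.induction_linear with
  | zero => simp
  | add p q hp hq => simp only [massOn_add, mul_add, hp, hq]
  | single h c =>
    classical
    simp [Set.indicator_apply]

theorem massOn_image_mul_right [Group G] (A : Set G) (g : G) (p : MonoidAlgebra ℝ G) :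
    massOn ((fun x => x * g) '' A) p = massOn A (p * single g⁻¹ 1) := by
  induction p using MonoidAlgebra.induction_linear with
  | zero => simp
  | add p q hp hq => simp only [massOn_add, add_mul, hp, hq]
  | single h c =>
    classical
    simp [Set.indicator_apply]

end MonoidAlgebra

/-! ### Reiter's condition and invariant means. -/

section Reiter

open MonoidAlgebra

/-- Reiter's condition: there are almost invariant finitely supported probability measures. -/
def IsReiter (G : Type*) [Group G] : Prop :=
  ∀ (S : Finset G) (ε : ℝ), 0 < ε → ∃ p : MonoidAlgebra ℝ G, IsProb p ∧
    ∀ s ∈ S, l1 (single s 1 * p - p) ≤ ε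

namespace IsInvariantMean

variable {G : Type*} [Group G] {μ : Set G → ℝ}

theorem empty (hμ : IsInvariantMean G μ) : μ ∅ = 0 := by
  have := hμ.union ∅ ∅ (Set.disjoint_empty _)
  simpa using this

theorem setOf_mem (hμ : IsInvariantMean G μ) {T : Type*} (φ : G → T) (s : Finset T) :
    μ {x | φ x ∈ s} = ∑ t ∈ s, μ {x | φ x = t} := by
  classical
  induction s using Finset.induction_on with
  | empty => simpa using hμ.empty
  | insert t s ht ih =>
    rw [Finset.sum_insert ht, ← ih, ← hμ.union]
    · congr 1
      ext x
      simp
    · rw [Set.disjoint_left]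
      rintro x rfl hx
      exact ht hx

/-- Both sides are the integral of `a (χ (φ x))` against μ. Working with finitely valued functions
avoids building an integral. -/
theorem sum_comp (hμ : IsInvariantMean G μ) {T C : Type*} [DecidableEq C] (φ : G → T)
    (R : Finset T) (hR : ∀ x, φ x ∈ R) (χ : T → C) (RC : Finset C) (hχ : ∀ t ∈ R, χ t ∈ RC)
    (a : C → ℝ) :
    ∑ t ∈ R, a (χ t) * μ {x | φ x = t} = ∑ c ∈ RC, a c * μ {x | χ (φ x) = c} := by
  rw [← Finset.sum_fiberwise_of_maps_to hχ]
  refine Finset.sum_congr rfl fun c _ => ?_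
  have h1 : {x | χ (φ x) = c} = {x | φ x ∈ R.filter fun t => χ t = c} := by
    ext x
    simp [hR x]
  rw [h1, hμ.setOf_mem, Finset.mul_sum]
  refine Finset.sum_congr rfl fun t ht => ?_
  rw [(Finset.mem_filter.1 ht).2]

/-- By left invariance the right-hand side has integral zero, so it cannot be at least 1 everywhere.
-/
theorem not_forall_one_le_sum (hμ : IsInvariantMean G μ) (S : Finset G) (n : S → G → ℤ) (N : ℤ)
    (hn : ∀ s x, n s x ∈ Finset.Icc (-N) N) :
    ¬ ∀ x, (1 : ℝ) ≤ ∑ s : S, ((n s (s * x) : ℝ) - n s x) := by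
  classical
  intro h
  let φ : G → S → ℤ × ℤ := fun x s => (n s (s * x), n s x)
  let I := Finset.Icc (-N) N
  let R : Finset (S → ℤ × ℤ) := Fintype.piFinset fun _ => I ×ˢ I
  have hR : ∀ x, φ x ∈ R := fun x =>
    Fintype.mem_piFinset.2 fun s => Finset.mem_product.2 ⟨hn _ _, hn _ _⟩
  have hR1 : ∀ s, ∀ t ∈ R, (t s).1 ∈ I := fun s t ht =>
    (Finset.mem_product.1 (Fintype.mem_piFinset.1 ht s)).1
  have hR2 : ∀ s, ∀ t ∈ R, (t s).2 ∈ I := fun s t ht =>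
    (Finset.mem_product.1 (Fintype.mem_piFinset.1 ht s)).2
  have htot : ∑ t ∈ R, μ {x | φ x = t} = 1 := by
    rw [← hμ.setOf_mem, ← hμ.univ]
    congr 1
    ext x
    simp [hR x]
  have hlow : 1 ≤ ∑ t ∈ R, (∑ s : S, (((t s).1 : ℝ) - (t s).2)) * μ {x | φ x = t} := by
    rw [← htot]
    refine Finset.sum_le_sum fun t _ => ?_
    rcases Set.eq_empty_or_nonempty {x | φ x = t} with h0 | ⟨x, rfl⟩
    · rw [h0, hμ.empty, mul_zero]
    · exact le_mul_of_one_le_left (hμ.mem_Icc _).1 (h x)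
  have hzero : ∑ t ∈ R, (∑ s : S, (((t s).1 : ℝ) - (t s).2)) * μ {x | φ x = t} = 0 := by
    simp_rw [Finset.sum_mul, sub_mul]
    rw [Finset.sum_comm]
    refine Finset.sum_eq_zero fun s _ => ?_
    rw [Finset.sum_sub_distrib, sub_eq_zero,
      hμ.sum_comp φ R hR (fun t => (t s).1) I (hR1 s) (fun c => (c : ℝ)),
      hμ.sum_comp φ R hR (fun t => (t s).2) I (hR2 s) (fun c => (c : ℝ))]
    refine Finset.sum_congr rfl fun c _ => ?_
    rw [← hμ.mul_left s]
    congr 2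
    ext x
    simp [φ]
  linarith

theorem not_forall_le_sum (hμ : IsInvariantMean G μ) (S : Finset G) (F : S → G → ℝ) (M : ℝ)
    (hF : ∀ s x, |F s x| ≤ M) {u : ℝ} (hu : 0 < u) :
    ¬ ∀ x, u ≤ ∑ s : S, (F s (s * x) - F s x) := by
  intro h
  -- Rounding down costs at most 1 for each member of `S`, so this scaling leaves c·u − |S| = 1.
  let c : ℝ := (S.card + 1) / u
  have hc : 0 < c := by positivity
  refine hμ.not_forall_one_le_sum S (fun s x => ⌊c * F s x⌋) (⌈c * M⌉ + 1) (fun s x => ?_)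
    fun x => ?_
  · have h1 : |c * F s x| ≤ c * M := by
      rw [abs_mul, abs_of_pos hc]
      exact mul_le_mul_of_nonneg_left (hF s x) hc.le
    obtain ⟨h2, h3⟩ := abs_le.1 h1
    have h4 := Int.le_ceil (c * M)
    rw [Finset.mem_Icc]
    constructor
    · rw [Int.le_floor]
      push_cast
      linarith
    · have h5 := Int.floor_le (c * F s x)
      have : ((⌊c * F s x⌋ : ℤ) : ℝ) ≤ ((⌈c * M⌉ + 1 : ℤ) : ℝ) := by
        push_cast
        linarith
      exact_mod_cast this
  · have h1 : ∀ s : S, c * (F s (s * x) - F s x) - 1 ≤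
        (⌊c * F s (s * x)⌋ : ℝ) - ⌊c * F s x⌋ := fun s => by
      have := Int.lt_floor_add_one (c * F s (s * x))
      have := Int.floor_le (c * F s x)
      linarith
    refine le_trans ?_ (Finset.sum_le_sum fun s _ => h1 s)
    rw [Finset.sum_sub_distrib, ← Finset.mul_sum]
    have h2 : c * u ≤ c * ∑ s : S, (F s (s * x) - F s x) := mul_le_mul_of_nonneg_left (h x) hc.le
    have h3 : c * u = S.card + 1 := by simp only [c]; field_simp
    simp only [Finset.sum_const, Finset.card_univ, Fintype.card_coe, nsmul_eq_mul, mul_one]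
    linarith

/-- Day's convexity argument. -/
theorem isReiter (hμ : IsInvariantMean G μ) : IsReiter G := by
  classical
  intro S ε hε
  by_contra! hno
  let : Norm (MonoidAlgebra ℝ G) := ⟨l1⟩
  have core : NormedSpace.Core ℝ (MonoidAlgebra ℝ G) :=
    { norm_nonneg := l1_nonneg
      norm_smul := fun c p => by rw [Real.norm_eq_abs]; exact l1_smul c p
      norm_triangle := l1_add_le
      norm_eq_zero_iff := fun p => ⟨eq_zero_of_l1, by rintro rfl; exact l1_zero⟩ }
  let : NormedAddCommGroup (MonoidAlgebra ℝ G) := NormedAddCommGroup.ofCore core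
  let : NormedSpace ℝ (MonoidAlgebra ℝ G) := NormedSpace.ofCore core
  let D : MonoidAlgebra ℝ G →ₗ[ℝ] (S → MonoidAlgebra ℝ G) :=
    LinearMap.pi fun s => LinearMap.mulLeft ℝ (single (s : G) (1 : ℝ)) - LinearMap.id
  have hD : ∀ p s, D p s = single (s : G) (1 : ℝ) * p - p := fun p s => rfl
  -- If Reiter's condition fails for `S` and ε, the convex set of all `D p` misses the ε-ball of the
  -- sup norm, and Hahn–Banach separates the two.
  have hdisj : Disjoint (Metric.ball (0 : S → MonoidAlgebra ℝ G) ε) (D '' {p | IsProb p}) := by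
    rw [Set.disjoint_left]
    rintro _ hball ⟨p, hp, rfl⟩
    obtain ⟨s, hs, hlt⟩ := hno p hp
    rw [mem_ball_zero_iff] at hball
    exact absurd ((norm_le_pi_norm (D p) ⟨s, hs⟩).trans_lt hball) (not_lt.2 hlt.le)
  obtain ⟨f, u, hfu, huf⟩ := geometric_hahn_banach_open (convex_ball _ _) Metric.isOpen_ball
    (convex_isProb.linear_image D) hdisj
  have hu : 0 < u := by
    have := hfu 0 (Metric.mem_ball_self hε)
    rwa [map_zero] at this
  -- Evaluating the separating functional on point masses gives bounded functions whose translation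
  -- differences add up to `f (D δ_x)`, hence to at least u > 0 at every x.
  refine hμ.not_forall_le_sum S (fun s x => f (Pi.single s (single x 1))) ‖f‖ (fun s x => ?_) hu
    fun x => ?_
  · refine (f.le_opNorm _).trans ?_
    rw [Pi.norm_single]
    have : ‖(single x 1 : MonoidAlgebra ℝ G)‖ = 1 := (l1_single x 1).trans abs_one
    rw [this, mul_one]
  · refine (huf _ ⟨_, IsProb.single x, rfl⟩).trans (le_of_eq ?_)
    rw [← Finset.univ_sum_single (D (single x 1)), map_sum]
    refine Finset.sum_congr rfl fun s _ => ?_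
    rw [hD, single_mul_single, one_mul, Pi.single_sub, map_sub]

end IsInvariantMean

/-! ### Permanence properties of Reiter's condition. -/

namespace IsReiter

variable {G K : Type*} [Group G] [Group K]

open Filter Topology in
/-- Limits of almost invariant finitely supported measures are invariant means. -/
theorem isAmenableGroup (h : IsReiter G) : IsAmenableGroup G := by
  classical
  choose p hp hinv using fun i : Finset G × ℕ => h i.1 (1 / ((i.2 : ℝ) + 1)) (by positivity)
  -- Multiplying by the inverted measure makes the result almost invariant on both sides: the left
  -- factor absorbs left translations, the right factor right ones.
  let q : Finset G × ℕ → MonoidAlgebra ℝ G := fun i => p i * mapDomain (fun g => g⁻¹) (p i)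
  have hq : ∀ i, IsProb (q i) := fun i => (hp i).mul ((hp i).mapDomain _)
  have hmap : ∀ (g : G) (r : MonoidAlgebra ℝ G), mapDomain (fun g => g⁻¹) r * single g⁻¹ 1 =
      mapDomain (fun g => g⁻¹) (single g 1 * r) := by
    intro g r
    induction r using MonoidAlgebra.induction_linear with
    | zero => simp
    | add a b ha hb => simp only [mapDomain_add, mul_add, add_mul, ha, hb]
    | single x c => simp
  have hql : ∀ i, ∀ g ∈ i.1, l1 (single g 1 * q i - q i) ≤ 1 / ((i.2 : ℝ) + 1) := by
    intro i g hg
    rw [← mul_assoc, ← sub_mul]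
    refine (l1_mul_le _ _).trans ?_
    rw [((hp i).mapDomain _).l1_eq, mul_one]
    exact hinv i g hg
  have hqr : ∀ i, ∀ g ∈ i.1, l1 (q i * single g⁻¹ 1 - q i) ≤ 1 / ((i.2 : ℝ) + 1) := by
    intro i g hg
    rw [mul_assoc, ← mul_sub]
    refine (l1_mul_le _ _).trans ?_
    rw [(hp i).l1_eq, one_mul, hmap, ← mapDomain_sub]
    exact (l1_mapDomain_le _ _).trans (hinv i g hg)
  let U : Ultrafilter (Finset G × ℕ) := Ultrafilter.of atTop
  have hU : (U : Filter (Finset G × ℕ)) ≤ atTop := Ultrafilter.of_le _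
  have hlim : ∀ A : Set G, ∃ L ∈ Set.Icc (0 : ℝ) 1,
      Tendsto (fun i => massOn A (q i)) U (𝓝 L) := fun A =>
    isCompact_Icc.ultrafilter_le_nhds (U.map fun i => massOn A (q i)) (by
      rw [le_principal_iff]
      exact Filter.mem_map.2 (Filter.univ_mem' fun i => (hq i).massOn_mem A))
  choose μ hμI hμ using hlim
  have hsmall : ∀ (g : G) (f : Finset G × ℕ → ℝ),
      (∀ i, g ∈ i.1 → |f i| ≤ 1 / ((i.2 : ℝ) + 1)) → Tendsto f U (𝓝 0) := by
    intro g f hf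
    have h1 : Tendsto (fun i : Finset G × ℕ => 1 / ((i.2 : ℝ) + 1)) U (𝓝 0) := by
      have h2 : Tendsto (Prod.snd : Finset G × ℕ → ℕ) atTop atTop := by
        rw [← prod_atTop_atTop_eq]
        exact tendsto_snd
      exact ((tendsto_one_div_add_atTop_nhds_zero_nat (𝕜 := ℝ)).comp h2).mono_left hU
    refine squeeze_zero_norm' (hU ?_) h1
    filter_upwards [eventually_ge_atTop (({g} : Finset G), 0)] with i hi
    exact hf i (Finset.singleton_subset_iff.1 hi.1)
  refine ⟨μ, hμI, ?_, fun A B hAB => ?_, fun g A => ?_, fun g A => ?_⟩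
  · refine tendsto_nhds_unique (hμ _) ?_
    simp only [(hq _).massOn_univ]
    exact tendsto_const_nhds
  · refine tendsto_nhds_unique (hμ _) ?_
    simp only [massOn_union hAB]
    exact (hμ A).add (hμ B)
  · refine sub_eq_zero.1 (tendsto_nhds_unique ((hμ _).sub (hμ _)) (hsmall g⁻¹ _ fun i hi => ?_))
    rw [massOn_image_mul_left, ← massOn_sub]
    exact (abs_massOn_le _ _).trans (hql i _ hi)
  · refine sub_eq_zero.1 (tendsto_nhds_unique ((hμ _).sub (hμ _)) (hsmall g _ fun i hi => ?_))
    rw [massOn_image_mul_right, ← massOn_sub]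
    exact (abs_massOn_le _ _).trans (hqr i _ hi)

/-- Almost invariant measures are pushed along a map that is equivariant for a homomorphism. -/
theorem exists_of_equivariant (hK : IsReiter K) (φ : G → K) (r : K → G)
    (hr : ∀ g x, r (φ g * x) = g * r x) : IsReiter G := by
  classical
  intro S ε hε
  obtain ⟨p, hp, hS⟩ := hK (S.image φ) ε hε
  refine ⟨mapDomain r p, hp.mapDomain r, fun s hs => ?_⟩
  have : single s 1 * mapDomain r p = mapDomain r (single (φ s) 1 * p) := by
    clear hS hp
    induction p using MonoidAlgebra.induction_linear with
    | zero => simp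
    | add a b ha hb => simp only [mapDomain_add, mul_add, ha, hb]
    | single x c => simp [hr]
  rw [this, ← mapDomain_sub]
  exact (l1_mapDomain_le _ _).trans (hS _ (Finset.mem_image_of_mem φ hs))

/-- With ρ(x) the chosen representative of the coset Hx, the map x ↦ xρ(x)⁻¹ from G to H is
H-equivariant, and measures are pushed along it. -/
theorem subgroup (h : IsReiter G) (H : Subgroup G) : IsReiter H := by
  let ρ : G → G := fun x => (Quotient.mk (QuotientGroup.rightRel H) x).out
  have hρ : ∀ x, x * (ρ x)⁻¹ ∈ H := fun x =>
    QuotientGroup.rightRel_apply.1 (Quotient.mk_out (s := QuotientGroup.rightRel H) x)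
  refine h.exists_of_equivariant (fun g : H => (g : G)) (fun x => ⟨x * (ρ x)⁻¹, hρ x⟩)
    fun g x => ?_
  have : ρ (g * x) = ρ x := by
    refine congrArg Quotient.out (Quotient.sound' (s₁ := QuotientGroup.rightRel H) ?_)
    rw [QuotientGroup.rightRel_apply]
    simp
  ext
  simp [this, mul_assoc]

/-- A group is Reiter if each finite subset lies in the image of a Reiter group. -/
theorem of_local {G : Type*} [Group G] (h : ∀ S : Finset G, ∃ (K : Type*) (_ : Group K)
    (φ : K →* G), IsReiter K ∧ ∀ s ∈ S, s ∈ φ.range) : IsReiter G := by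
  classical
  intro S ε hε
  obtain ⟨K, _, φ, hK, hS⟩ := h S
  choose! σ hσ using hS
  obtain ⟨p, hp, hpS⟩ := hK (S.image σ) ε hε
  refine ⟨mapDomain φ p, hp.mapDomain φ, fun s hs => ?_⟩
  have : single s 1 * mapDomain φ p = mapDomain φ (single (σ s) 1 * p) := by
    rw [mapDomain_mul, mapDomain_single, hσ s hs]
  rw [this, ← mapDomain_sub]
  exact (l1_mapDomain_le _ _).trans (hpS _ (Finset.mem_image_of_mem σ hs))

theorem of_surjective (hK : IsReiter K) (φ : K →* G) (hφ : Function.Surjective φ) : IsReiter G :=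
  of_local fun _ => ⟨K, _, φ, hK, fun s _ => hφ s⟩

/-- The measure is a lift of one on the quotient times one on the kernel. Each factor contributes
ε/2 to the error. -/
theorem of_extension (f : G →* K) (hf : Function.Surjective f) (hK : IsReiter K)
    (hker : IsReiter f.ker) : IsReiter G := by
  classical
  intro S ε hε
  obtain ⟨q, hq, hqS⟩ := hK (S.image f) (ε / 2) (half_pos hε)
  let σ : K → G := Function.surjInv hf
  have hσ : ∀ x, f (σ x) = x := Function.surjInv_eq hf
  -- This is the cocycle in s·σ(x) = σ(f(s)x)·n(s, x). The kernel measure need only be almost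
  -- invariant under its finitely many values for s in `S` and x in the support of `q`.
  let n : G → K → f.ker := fun s x => ⟨(σ (f s * x))⁻¹ * (s * σ x), by
    simp [MonoidHom.mem_ker, hσ]⟩
  obtain ⟨p, hp, hpS⟩ := hker (Finset.image₂ n S q.coeff.support) (ε / 2) (half_pos hε)
  have hP : IsProb (mapDomain f.ker.subtype p) := hp.mapDomain _
  set P := mapDomain f.ker.subtype p with hPdef
  refine ⟨mapDomain σ q * P, (hq.mapDomain σ).mul hP, fun s hs => ?_⟩
  have h1 : l1 (single s 1 * mapDomain σ q * P - mapDomain σ (single (f s) 1 * q) * P) ≤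
      ε / 2 := by
    have h2 : single s 1 * mapDomain σ q * P - mapDomain σ (single (f s) 1 * q) * P =
        ∑ x ∈ q.coeff.support, single (σ (f s * x)) (q.coeff x) *
          mapDomain f.ker.subtype (single (n s x) 1 * p - p) := by
      have h3 : mapDomain σ (single (f s) 1 * q) =
          ∑ x ∈ q.coeff.support, single (σ (f s * x)) (q.coeff x) := by
        rw [← mapDomain_eq_sum (fun x => σ (f s * x))]
        generalize q = r
        induction r using MonoidAlgebra.induction_linear with
        | zero => simp
        | add a b ha hb => simp only [mapDomain_add, mul_add, ha, hb]
        | single x c => simp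
      rw [h3, mapDomain_eq_sum σ q, Finset.mul_sum, Finset.sum_mul, Finset.sum_mul,
        ← Finset.sum_sub_distrib]
      refine Finset.sum_congr rfl fun x _ => ?_
      rw [mapDomain_sub, mapDomain_mul, mapDomain_single, mul_sub, ← mul_assoc,
        single_mul_single, single_mul_single, ← hPdef]
      simp [n]
    rw [h2]
    refine (l1_sum_le _ _).trans ?_
    calc _ ≤ ∑ x ∈ q.coeff.support, |q.coeff x| * (ε / 2) := by
          refine Finset.sum_le_sum fun x hx => (l1_mul_le _ _).trans ?_
          rw [l1_single]
          exact mul_le_mul_of_nonneg_left ((l1_mapDomain_le _ _).trans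
            (hpS _ (Finset.mem_image₂_of_mem hs hx))) (abs_nonneg _)
      _ = ε / 2 := by
          rw [← Finset.sum_mul]
          have := hq.l1_eq
          rw [l1, Finsupp.sum] at this
          rw [this, one_mul]
  have h2 : l1 (mapDomain σ (single (f s) 1 * q) * P - mapDomain σ q * P) ≤ ε / 2 := by
    rw [← sub_mul, ← mapDomain_sub]
    refine (l1_mul_le _ _).trans ?_
    rw [hP.l1_eq, mul_one]
    exact (l1_mapDomain_le _ _).trans (hqS _ (Finset.mem_image_of_mem f hs))
  calc _ = l1 ((single s 1 * mapDomain σ q * P - mapDomain σ (single (f s) 1 * q) * P) +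
        (mapDomain σ (single (f s) 1 * q) * P - mapDomain σ q * P)) := by
        rw [sub_add_sub_cancel, mul_assoc]
    _ ≤ ε := (l1_add_le _ _).trans (by linarith)

theorem multiplicative_int : IsReiter (Multiplicative ℤ) := by
  intro S ε hε
  obtain ⟨M, hM⟩ : ∃ M : ℕ, ∀ s ∈ S, s.toAdd.natAbs ≤ M :=
    ⟨S.sup fun s => s.toAdd.natAbs, fun s hs => Finset.le_sup (f := fun s => s.toAdd.natAbs) hs⟩
  -- The uniform measure on n + 1 consecutive powers of the generator moves by at most 2m/(n + 1)
  -- under translation by ±m, and m ≤ M.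
  obtain ⟨n, hn⟩ := exists_nat_gt (2 * M / ε)
  let t : Multiplicative ℤ := Multiplicative.ofAdd 1
  let p : MonoidAlgebra ℝ (Multiplicative ℤ) :=
    ((n + 1 : ℝ)⁻¹) • ∑ i ∈ Finset.range (n + 1), single (t ^ i) 1
  have hn0 : (0 : ℝ) < n + 1 := by positivity
  have hp : IsProb p := by
    classical
    constructor
    · intro g
      simp only [p, coeff_smul, Finsupp.smul_apply, coeff_sum, Finsupp.finsetSum_apply, smul_eq_mul]
      refine mul_nonneg (by positivity) (Finset.sum_nonneg fun i _ => (IsProb.single _).nonneg g)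
    · have hsum : ∀ s : Finset ℕ, mass (∑ i ∈ s, single (t ^ i) (1 : ℝ)) = s.card := by
        intro s
        induction s using Finset.induction_on with
        | empty => simp
        | insert a s ha ih => simp [Finset.sum_insert ha, mass_add, ih, ha, add_comm]
      rw [mass_smul, hsum, Finset.card_range]
      push_cast
      field_simp
  have ht : l1 (single t 1 * p - p) ≤ 2 / (n + 1) := by
    have h1 : single t 1 * p - p = ((n + 1 : ℝ)⁻¹) • (single (t ^ (n + 1)) 1 - single 1 1) := by
      rw [mul_smul_comm, ← smul_sub, Finset.mul_sum, ← Finset.sum_sub_distrib]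
      congr 1
      simp only [single_mul_single, one_mul, ← pow_succ']
      rw [Finset.sum_range_sub (fun i => single (t ^ i) (1 : ℝ)), pow_zero]
    rw [h1, l1_smul, abs_of_pos (inv_pos.2 hn0), div_eq_inv_mul]
    refine mul_le_mul_of_nonneg_left ?_ (inv_pos.2 hn0).le
    rw [sub_eq_add_neg]
    refine (l1_add_le _ _).trans ?_
    rw [l1_neg]
    norm_num
  have hpow : ∀ m : ℕ, l1 (single (t ^ m) 1 * p - p) ≤ m * (2 / (n + 1)) := by
    intro m
    induction m with
    | zero => simp [← one_def]
    | succ m ih =>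
      have : single (t ^ (m + 1)) 1 * p - p =
          single t 1 * (single (t ^ m) 1 * p - p) + (single t 1 * p - p) := by
        rw [mul_sub, ← mul_assoc, single_mul_single, one_mul, ← pow_succ', sub_add_sub_cancel]
      rw [this]
      refine (l1_add_le _ _).trans ?_
      have h2 := l1_mul_le (single t 1) (single (t ^ m) 1 * p - p)
      rw [l1_single, abs_one, one_mul] at h2
      push_cast
      linarith
  have hinv : ∀ g, l1 (single g⁻¹ 1 * p - p) ≤ l1 (single g 1 * p - p) := by
    intro g
    have : single g⁻¹ 1 * p - p = single g⁻¹ 1 * (p - single g 1 * p) := by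
      rw [mul_sub, ← mul_assoc, single_mul_single, inv_mul_cancel, one_mul, ← one_def, one_mul]
    rw [this, l1_sub_comm _ p]
    refine (l1_mul_le _ _).trans ?_
    simp
  refine ⟨p, hp, fun s hs => ?_⟩
  have hle : l1 (single s 1 * p - p) ≤ s.toAdd.natAbs * (2 / (n + 1)) := by
    rcases Int.natAbs_eq s.toAdd with h | h
    · have : s = t ^ s.toAdd.natAbs := by
        apply Multiplicative.toAdd.injective
        simpa [t] using h
      conv_lhs => rw [this]
      exact hpow _
    · have : s = (t ^ s.toAdd.natAbs)⁻¹ := by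
        apply Multiplicative.toAdd.injective
        simpa [t] using h
      conv_lhs => rw [this]
      exact (hinv _).trans (hpow _)
  refine hle.trans ?_
  have h1 : (s.toAdd.natAbs : ℝ) ≤ M := by exact_mod_cast hM s hs
  have h2 : 2 * M < n * ε := (div_lt_iff₀ hε).1 hn
  rw [mul_div_assoc', div_le_iff₀ hn0]
  nlinarith

/-- Evaluation at one coordinate exhibits the power as an extension of G by a smaller power. -/
theorem pi_fin (h : IsReiter G) (n : ℕ) : IsReiter (Fin n → G) := by
  induction n with
  | zero =>
    exact fun S ε hε => ⟨single 1 1, IsProb.single 1, fun s _ => by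
      rw [Subsingleton.elim s 1, ← one_def, one_mul, sub_self, l1_zero]; exact hε.le⟩
  | succ n ih =>
    let f : (Fin (n + 1) → G) →* G := Pi.evalMonoidHom _ 0
    refine of_extension f (fun g => ⟨fun _ => g, rfl⟩) h ?_
    let φ : (Fin n → G) →* f.ker :=
      { toFun := fun x => ⟨Fin.cons 1 x, by simp [f, MonoidHom.mem_ker]⟩
        map_one' := by ext i; refine Fin.cases ?_ (fun i => ?_) i <;> simp
        map_mul' := fun x y => by ext i; refine Fin.cases ?_ (fun i => ?_) i <;> simp }
    refine ih.of_surjective φ fun x => ⟨Fin.tail x.1, ?_⟩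
    ext i
    refine Fin.cases ?_ (fun i => ?_) i
    · exact (MonoidHom.mem_ker.1 x.2).symm
    · simp [φ, Fin.tail]

theorem pi {ι : Type*} [Finite ι] (h : IsReiter G) : IsReiter (ι → G) := by
  obtain ⟨n, ⟨e⟩⟩ := Finite.exists_equiv_fin ι
  refine (h.pi_fin n).of_surjective
    { toFun := fun x i => x (e i), map_one' := rfl, map_mul' := fun _ _ => rfl }
    fun x => ⟨fun i => x (e.symm i), ?_⟩
  ext i
  simp

end IsReiter

theorem IsAmenableGroup.isReiter {G : Type*} [Group G] (h : IsAmenableGroup G) : IsReiter G :=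
  h.elim fun _ hμ => hμ.isReiter

end Reiter

/-! ### Amenability, torsion and generation of wreath products. -/

section Wreath

variable {D Q : Type*} [Group D] [Group Q]

/-- The copy of `Q` in the restricted wreath product. -/
def wreathInl : Q →* restrictedWreath D Q where
  toFun q := ⟨RegularWreathProduct.inl q, by simp [restrictedWreath]⟩
  map_one' := by ext <;> simp
  map_mul' a b := by ext <;> simp

@[simp]
theorem wreathInl_left (q : Q) : ((wreathInl q : restrictedWreath D Q) : D ≀ᵣ Q).left = 1 := rfl

@[simp]
theorem wreathInl_right (q : Q) : ((wreathInl q : restrictedWreath D Q) : D ≀ᵣ Q).right = q := rfl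

variable (D Q) in
/-- The projection of the restricted wreath product onto `Q`. -/
def wreathRight : restrictedWreath D Q →* Q :=
  RegularWreathProduct.rightHom.comp (restrictedWreath D Q).subtype

theorem mem_wreathRight_ker {w : restrictedWreath D Q} :
    w ∈ (wreathRight D Q).ker ↔ (w : D ≀ᵣ Q).right = 1 := Iff.rfl

/-- The kernel of the projection to Q is a direct sum, so any finite subset of it lies in a finite
power of D. -/
theorem IsReiter.restrictedWreath (hD : IsReiter D) (hQ : IsReiter Q) :
    IsReiter (restrictedWreath D Q) := by
  classical
  refine IsReiter.of_extension (wreathRight D Q) (fun q => ⟨wreathInl q, rfl⟩) hQ ?_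
  refine IsReiter.of_local fun S => ?_
  let F : Finset Q := S.biUnion fun w => Set.Finite.toFinset w.1.2
  let ext : (F → D) → Q → D := fun x q => if h : q ∈ F then x ⟨q, h⟩ else 1
  have hext : ∀ x, (Function.mulSupport (ext x)).Finite := fun x =>
    F.finite_toSet.subset fun q hq => by
      by_contra h
      exact hq (dif_neg h)
  let φ : (F → D) →* (wreathRight D Q).ker :=
    { toFun := fun x => ⟨⟨⟨ext x, 1⟩, hext x⟩, rfl⟩
      map_one' := by
        ext q
        · simp [ext]
        · rfl
      map_mul' := fun x y => by
        ext q
        · by_cases h : q ∈ F <;> simp [ext, h]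
        · simp }
  refine ⟨F → D, inferInstance, φ, hD.pi, fun w hw => ⟨fun q => w.1.1.left q, ?_⟩⟩
  ext q
  · by_cases h : q ∈ F
    · simp [φ, ext, h]
    · have h1 : w.1.1.left q = 1 := by
        by_contra hne
        exact h (Finset.mem_biUnion.2 ⟨w, hw, w.1.2.mem_toFinset.2 hne⟩)
      simp [φ, ext, h, h1]
  · exact (mem_wreathRight_ker.1 w.2).symm

/-- An element of finite order projects trivially to Q, so it lies in the base, where powers are
taken place by place. -/
theorem IsTorsionFreeGroup.restrictedWreath (hD : IsTorsionFreeGroup D)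
    (hQ : IsTorsionFreeGroup Q) : IsTorsionFreeGroup (restrictedWreath D Q) := by
  intro w hw
  have hr : (w : D ≀ᵣ Q).right = 1 := hQ _ ((wreathRight D Q).isOfFinOrder hw)
  have hpow : ∀ n : ℕ, (w ^ n : D ≀ᵣ Q).right = 1 ∧ ∀ q, (w ^ n : D ≀ᵣ Q).left q =
      (w : D ≀ᵣ Q).left q ^ n := by
    intro n
    induction n with
    | zero => simp
    | succ n ih => simp [pow_succ, ih.1, ih.2, hr]
  obtain ⟨n, hn, h1⟩ := isOfFinOrder_iff_pow_eq_one.1 hw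
  ext q
  · refine hD _ (isOfFinOrder_iff_pow_eq_one.2 ⟨n, hn, ?_⟩)
    rw [← (hpow n).2 q, ← Subgroup.coe_pow, h1]
    simp
  · exact hr

/-- Conjugation by q carries the copy of D at the place 1 to the place q. Finite support then lets a
base element be stripped one place at a time. -/
theorem sup_range_wreathSingle_wreathInl :
    (wreathSingle (D := D) (1 : Q)).range ⊔ (wreathInl (D := D) (Q := Q)).range = ⊤ := by
  classical
  rw [eq_top_iff]
  set K := (wreathSingle (D := D) (1 : Q)).range ⊔ (wreathInl (D := D) (Q := Q)).range
  have hI : ∀ q : Q, wreathInl q ∈ K := fun q => le_sup_right (α := Subgroup _) ⟨q, rfl⟩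
  have hS1 : ∀ d : D, wreathSingle (1 : Q) d ∈ K := fun d =>
    le_sup_left (α := Subgroup _) ⟨d, rfl⟩
  have hS : ∀ (q : Q) (d : D), wreathSingle q d ∈ K := by
    intro q d
    have : wreathSingle q d = wreathInl q * wreathSingle 1 d * wreathInl q⁻¹ := by
      ext x
      · simp [Pi.mulSingle_apply, inv_mul_eq_one, eq_comm (a := q)]
      · simp
    rw [this]
    exact K.mul_mem (K.mul_mem (hI q) (hS1 d)) (hI _)
  have hB : ∀ (F : Finset Q) (w : restrictedWreath D Q), (w : D ≀ᵣ Q).right = 1 →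
      (∀ q, q ∉ F → (w : D ≀ᵣ Q).left q = 1) → w ∈ K := by
    intro F
    induction F using Finset.induction_on with
    | empty =>
      intro w hr hw
      have : w = 1 := by
        ext q
        · exact hw q (Finset.notMem_empty q)
        · exact hr
      rw [this]
      exact K.one_mem
    | insert p F hp ih =>
      intro w hr hw
      rw [← K.mul_mem_cancel_right (hS p ((w : D ≀ᵣ Q).left p)⁻¹)]
      refine ih _ (by simp [hr]) fun q hq => ?_
      by_cases hqp : q = p
      · subst hqp
        simp [hr]
      · simp [hr, hqp, hw q (by simp [hqp, hq])]
  intro w _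
  rw [← K.mul_mem_cancel_right (hI (w : D ≀ᵣ Q).right⁻¹)]
  refine hB w.2.toFinset _ (by simp) fun q hq => ?_
  have : (w : D ≀ᵣ Q).left q = 1 := by
    by_contra hne
    exact hq (w.2.mem_toFinset.2 hne)
  simp [this]

theorem fg_restrictedWreath [Group.FG D] [Group.FG Q] : Group.FG (restrictedWreath D Q) := by
  rw [Group.fg_def, ← sup_range_wreathSingle_wreathInl]
  exact ((Group.fg_iff_subgroup_fg _).1 (Group.fg_range _)).sup
    ((Group.fg_iff_subgroup_fg _).1 (Group.fg_range _))

end Wreath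

/-! ### The infinite cyclic case and finitely generated subgroups. -/

theorem isTorsionFreeGroup_multiplicative_int : IsTorsionFreeGroup (Multiplicative ℤ) := by
  intro g hg
  obtain ⟨n, hn, h⟩ := isOfFinOrder_iff_pow_eq_one.1 hg
  have h' : (n : ℤ) * g.toAdd = 0 := by simpa using congrArg Multiplicative.toAdd h
  exact Multiplicative.toAdd.injective
    ((mul_eq_zero.1 h').resolve_left (by exact_mod_cast hn.ne'))

theorem IsTorsionFreeGroup.subgroup {G : Type*} [Group G] (h : IsTorsionFreeGroup G)
    (H : Subgroup G) : IsTorsionFreeGroup H := fun g hg =>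
  Subtype.ext (h g (H.subtype.isOfFinOrder hg))

theorem IsTorsionFreeGroup.hasBoundedFiniteSubgroups {G : Type*} [Group G]
    (h : IsTorsionFreeGroup G) : HasBoundedFiniteSubgroups G := by
  refine ⟨1, fun F _ => ?_⟩
  have : F = ⊥ := (Subgroup.eq_bot_iff_forall F).2 fun g hg =>
    congrArg Subtype.val (h.subgroup F ⟨g, hg⟩ (isOfFinOrder_of_finite _))
  rw [this, Subgroup.card_bot]

/-- A zero divisor in a group algebra lives over a finitely generated subgroup. -/
theorem exists_fg_subgroup_not_isDomain {H k : Type*} [Group H] [Field k]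
    (h : ¬ IsDomain (MonoidAlgebra k H)) :
    ∃ H₀ : Subgroup H, H₀.FG ∧ ¬ IsDomain (MonoidAlgebra k H₀) := by
  classical
  obtain ⟨a, b, hab, ha, hb⟩ : ∃ a b : MonoidAlgebra k H, a * b = 0 ∧ a ≠ 0 ∧ b ≠ 0 := by
    by_contra! hno
    refine h (@NoZeroDivisors.to_isDomain _ _ _ ⟨fun {a b} hab => ?_⟩)
    by_cases ha : a = 0
    · exact Or.inl ha
    · exact Or.inr (hno a b hab ha)
  -- Both zero divisors have support in this subgroup, so they restrict to zero divisors of its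
  -- group algebra.
  let H₀ : Subgroup H := Subgroup.closure (a.coeff.support ∪ b.coeff.support : Finset H)
  have hinj : Function.Injective H₀.subtype := H₀.subtype_injective
  have hlift : ∀ x : MonoidAlgebra k H, x.coeff.support ⊆ a.coeff.support ∪ b.coeff.support →
      ∃ y : MonoidAlgebra k H₀, MonoidAlgebra.mapDomain H₀.subtype y = x := fun x hx =>
    ⟨MonoidAlgebra.comapDomain H₀.subtype hinj x,
      MonoidAlgebra.mapDomain_comapDomain (fun g hg =>
        ⟨⟨g, Subgroup.subset_closure (hx hg)⟩, rfl⟩) hinj⟩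
  obtain ⟨a', ha'⟩ := hlift a Finset.subset_union_left
  obtain ⟨b', hb'⟩ := hlift b Finset.subset_union_right
  refine ⟨H₀, ⟨_, rfl⟩, fun hdom => ?_⟩
  have h0 : a' * b' = 0 := by
    apply MonoidAlgebra.mapDomain_injective hinj
    rw [MonoidAlgebra.mapDomain_mul, ha', hb', hab, MonoidAlgebra.mapDomain_zero]
  rcases mul_eq_zero.1 h0 with h1 | h1
  · exact ha (by rw [← ha', h1, MonoidAlgebra.mapDomain_zero])
  · exact hb (by rw [← hb', h1, MonoidAlgebra.mapDomain_zero])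

/-- The lamplighter group over a torsion-free amenable group with a group algebra that is not a
domain. -/
theorem lamplighter_counterexample {H k : Type*} [Group H] [Field k] [CharZero k]
    (htf : IsTorsionFreeGroup H) (hH : IsReiter H) (hdom : ¬ IsDomain (MonoidAlgebra k H)) :
    IsTorsionFreeGroup (Lamplighter H) ∧ IsAmenableGroup (Lamplighter H) ∧
      rightUdim (MonoidAlgebra k (Lamplighter H)) = ⊤ ∧
      ¬ (IsAmenableGroup (Lamplighter H) ∧ HasBoundedFiniteSubgroups (Lamplighter H) →
          rightUdim (MonoidAlgebra k (Lamplighter H)) < ⊤) := by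
  have h1 : IsTorsionFreeGroup (Lamplighter H) :=
    htf.restrictedWreath isTorsionFreeGroup_multiplicative_int
  have h2 : IsAmenableGroup (Lamplighter H) :=
    (hH.restrictedWreath IsReiter.multiplicative_int).isAmenableGroup
  have h3 : rightUdim (MonoidAlgebra k (Lamplighter H)) = ⊤ := rightUdim_restrictedWreath hdom
  exact ⟨h1, h2, h3, fun h => (h ⟨h2, h1.hasBoundedFiniteSubgroups⟩).ne h3⟩

theorem mainTheorem5 {H : Type u} [Group H] {k : Type v} [Field k] [CharZero k]
    (htf : IsTorsionFreeGroup H) (ham : IsAmenableGroup H)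
    (hdom : ¬ IsDomain (MonoidAlgebra k H)) :
    -- a finitely generated torsion-free amenable `G` with `udim kG = ∞`
    (∃ (G : Type u) (_ : Group G),
      Group.FG G ∧ IsTorsionFreeGroup G ∧ IsAmenableGroup G ∧
      rightUdim (MonoidAlgebra k G) = ⊤ ∧
      ¬ (IsAmenableGroup G ∧ HasBoundedFiniteSubgroups G →
          rightUdim (MonoidAlgebra k G) < ⊤) ∧
      ∃ H₀ : Subgroup H, H₀.FG ∧ ¬ IsDomain (MonoidAlgebra k H₀) ∧
        Nonempty (G ≃* Lamplighter H₀)) ∧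
    -- `H ≀ C_∞` itself; it is finitely generated as soon as `H` is
    (IsTorsionFreeGroup (Lamplighter H) ∧ IsAmenableGroup (Lamplighter H) ∧
      rightUdim (MonoidAlgebra k (Lamplighter H)) = ⊤ ∧
      ¬ (IsAmenableGroup (Lamplighter H) ∧ HasBoundedFiniteSubgroups (Lamplighter H) →
          rightUdim (MonoidAlgebra k (Lamplighter H)) < ⊤) ∧
      (Group.FG H → Group.FG (Lamplighter H))) := by
  have hR := ham.isReiter
  refine ⟨?_, ?_⟩
  · obtain ⟨H₀, hfg, hdom₀⟩ := exists_fg_subgroup_not_isDomain hdom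
    obtain ⟨h1, h2, h3, h4⟩ :=
      lamplighter_counterexample (htf.subgroup H₀) (hR.subgroup H₀) hdom₀
    have : Group.FG H₀ := (Group.fg_iff_subgroup_fg H₀).2 hfg
    exact ⟨Lamplighter H₀, inferInstance, fg_restrictedWreath, h1, h2, h3, h4, H₀, hfg, hdom₀,
      ⟨MulEquiv.refl _⟩⟩
  · obtain ⟨h1, h2, h3, h4⟩ := lamplighter_counterexample htf hR hdom
    exact ⟨h1, h2, h3, h4, fun _ => fg_restrictedWreath⟩
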